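/- A city consists of an axis-parallel rectangle $P$ in the ground plane and $k$ vertical buildings: right prisms of positive height whose bases are pairwise disjoint closed rectangles, of arbitrary orientation, in the interior of $P$. A vertex guard (with $180^\circ$ vision) is placed at one of the top vertices of a building and is aligned with that building: its field of vision is one of the closed half-spaces bounded by a vertical plane through that vertex parallel to one of the walls of the building. (Two guards with different orientations at the same vertex count as two.) A guard sees a point $q$ if $q$ lies in its field of vision and the segment from the guard to $q$ does not meet the interior of any building. The city is guarded by a set of guards if every point of the ground (the part of $P$ not in the interior of the base of a building), of the walls and of the roofs is seen by at least one guard of the set. Theorem. For every natural number $k$ there is a city with $k$ buildings such that every set of vertex guards that guards the city consists of at least $3k+1$ guards. -/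

import Mathlib

/-- A vertical building: a right prism over a (closed, arbitrarily oriented) rectangle in the
ground plane. The base has one corner at `corner`; one pair of sides is parallel to the unit
vector `dir` and has length `length`, the other pair is parallel to `dir` rotated
counterclockwise by a right angle and has length `width`. -/
structure Building where
  corner : ℝ × ℝ
  dir : ℝ × ℝ
  length : ℝ
  width : ℝ
  height : ℝ
  dir_unit : dir.1 ^ 2 + dir.2 ^ 2 = 1
  length_pos : 0 < length
  width_pos : 0 < width
  height_pos : 0 < height

namespace Building

/-- The unit vector obtained by rotating `dir` counterclockwise by a right angle. -/
def perp (B : Building) : ℝ × ℝ := (-B.dir.2, B.dir.1)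

/-- The (closed) rectangular base, in the ground plane. -/
def base (B : Building) : Set (ℝ × ℝ) :=
  {p | ∃ s ∈ Set.Icc 0 B.length, ∃ t ∈ Set.Icc 0 B.width,
    p = B.corner + s • B.dir + t • B.perp}

/-- The (closed) solid prism. Points of space are pairs (horizontal position, altitude). -/
def solid (B : Building) : Set ((ℝ × ℝ) × ℝ) := B.base ×ˢ Set.Icc 0 B.height

/-- The roof. -/
def roof (B : Building) : Set ((ℝ × ℝ) × ℝ) := B.base ×ˢ {B.height}

/-- The union of the four walls. -/
def walls (B : Building) : Set ((ℝ × ℝ) × ℝ) := frontier B.base ×ˢ Set.Icc 0 B.height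

/-- The four corners of the base. -/
def baseVertex (B : Building) (i j : Bool) : ℝ × ℝ :=
  B.corner + (if i then B.length else 0) • B.dir + (if j then B.width else 0) • B.perp

/-- The four top vertices of the building. -/
def topVertex (B : Building) (i j : Bool) : (ℝ × ℝ) × ℝ := (B.baseVertex i j, B.height)

end Building

/-- The four horizontal directions normal to the walls of a building. -/
inductive Facing where
  | forward
  | backward
  | left
  | right

/-- The horizontal unit vector of a facing, relative to a given building. -/
def Building.facingVec (B : Building) : Facing → ℝ × ℝ
  | .forward => B.dir
  | .backward => -B.dir
  | .left => B.perp
  | .right => -B.perp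

/-- A rectangular city with `k` vertical buildings: an axis-parallel rectangle `[lo, hi]` and `k`
pairwise disjoint buildings whose bases lie in its interior. -/
structure City (k : ℕ) where
  lo : ℝ × ℝ
  hi : ℝ × ℝ
  lo_lt_hi_fst : lo.1 < hi.1
  lo_lt_hi_snd : lo.2 < hi.2
  building : Fin k → Building
  base_subset : ∀ i, (building i).base ⊆ Set.Ioo lo.1 hi.1 ×ˢ Set.Ioo lo.2 hi.2
  disjoint : ∀ i j, i ≠ j → Disjoint (building i).base (building j).base

/-- A vertex guard: the building it stands on, the top vertex of that building at which it is
placed, and the direction (normal to a wall of that building) in which it faces. -/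
structure Guard (k : ℕ) where
  index : Fin k
  i : Bool
  j : Bool
  facing : Facing

namespace City

variable {k : ℕ}

/-- The bounding rectangle of the city. -/
def region (C : City k) : Set (ℝ × ℝ) := Set.Icc C.lo.1 C.hi.1 ×ˢ Set.Icc C.lo.2 C.hi.2

/-- The ground: the part of the bounding rectangle (at altitude `0`) which is not in the interior
of the base of a building. -/
def ground (C : City k) : Set ((ℝ × ℝ) × ℝ) :=
  (C.region \ ⋃ i, interior (C.building i).base) ×ˢ {0}

/-- What has to be guarded: the ground, the walls and the roofs. -/
def surface (C : City k) : Set ((ℝ × ℝ) × ℝ) :=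
  C.ground ∪ (⋃ i, (C.building i).walls) ∪ ⋃ i, (C.building i).roof

/-- The position of a guard. -/
def position (C : City k) (g : Guard k) : (ℝ × ℝ) × ℝ :=
  (C.building g.index).topVertex g.i g.j

/-- The field of vision of a guard: the closed half-space in front of it, bounded by the vertical
plane through the guard orthogonal to its facing, hence parallel to a wall of its building. -/
def vision (C : City k) (g : Guard k) : Set ((ℝ × ℝ) × ℝ) :=
  {q | 0 ≤ (q.1.1 - (C.position g).1.1) * ((C.building g.index).facingVec g.facing).1
          + (q.1.2 - (C.position g).1.2) * ((C.building g.index).facingVec g.facing).2}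

/-- Two points see each other if the segment between them does not meet the interior of any
building. -/
def MutuallyVisible (C : City k) (p q : (ℝ × ℝ) × ℝ) : Prop :=
  ∀ i, Disjoint (segment ℝ p q) (interior (C.building i).solid)

/-- The guard sees the point. -/
def Sees (C : City k) (g : Guard k) (q : (ℝ × ℝ) × ℝ) : Prop :=
  q ∈ C.vision g ∧ C.MutuallyVisible (C.position g) q

/-- A set of guards guards the city if every point of the ground, the walls and the roofs is seen
by some guard in the set. -/
def IsGuardedBy (C : City k) (G : Finset (Guard k)) : Prop :=
  ∀ q ∈ C.surface, ∃ g ∈ G, C.Sees g q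

end City

/-! A tower of bars of unit width and height is built, each new bar tilted slightly and placed
beyond the `left` wall of its predecessor, so that all earlier bars lie in a box (`core`) facing its
`right` wall. Test points are ground points just in front of the midpoints of the `left`, `backward`
and `forward` walls of every bar, and of the `right` wall of bar `0`: `3k + 1` points. It suffices
that each guard sees at most one of them (`City.eventually_not_sees_of_watched_ne`). On its own bar
a guard reaches at most one test wall. Its later bars hide their own test walls from it. Looking
back, upper vertices are blocked by their own bar, and lower vertices by the preceding bar, except
that the first lower vertex reaches the `left` wall of that bar and the second its `forward` wall. A
guard facing so as to use this exception has the `right` wall as its only own wall, which is not a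
test wall for later bars, so one assigned wall remains. `Stage.exists_precedes` supplies the
geometry. -/

open Filter Topology

/-! ### Planar coordinates and blocking by a single rectangle -/

namespace Building

/-- First coordinate in the frame of the building. -/
def xc (B : Building) (p : ℝ × ℝ) : ℝ :=
  (p.1 - B.corner.1) * B.dir.1 + (p.2 - B.corner.2) * B.dir.2

/-- Second coordinate in the frame of the building. -/
def yc (B : Building) (p : ℝ × ℝ) : ℝ :=
  (p.2 - B.corner.2) * B.dir.1 - (p.1 - B.corner.1) * B.dir.2

/-- The point with given coordinates in the frame of the building. -/
def point (B : Building) (x y : ℝ) : ℝ × ℝ := B.corner + x • B.dir + y • B.perp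

theorem point_fst (B : Building) (x y : ℝ) :
    (B.point x y).1 = B.corner.1 + x * B.dir.1 - y * B.dir.2 := by
  simp [point, perp]; ring

theorem point_snd (B : Building) (x y : ℝ) :
    (B.point x y).2 = B.corner.2 + x * B.dir.2 + y * B.dir.1 := by
  simp [point, perp]

@[simp] theorem xc_point (B : Building) (x y : ℝ) : B.xc (B.point x y) = x := by
  rw [xc, point_fst, point_snd]
  linear_combination x * B.dir_unit

@[simp] theorem yc_point (B : Building) (x y : ℝ) : B.yc (B.point x y) = y := by
  rw [yc, point_fst, point_snd]
  linear_combination y * B.dir_unit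

theorem point_xc_yc (B : Building) (p : ℝ × ℝ) : B.point (B.xc p) (B.yc p) = p := by
  have h := B.dir_unit
  ext
  · rw [point_fst, xc, yc]; linear_combination (p.1 - B.corner.1) * h
  · rw [point_snd, xc, yc]; linear_combination (p.2 - B.corner.2) * h

theorem mem_base (B : Building) (p : ℝ × ℝ) :
    p ∈ B.base ↔ (0 ≤ B.xc p ∧ B.xc p ≤ B.length) ∧ 0 ≤ B.yc p ∧ B.yc p ≤ B.width := by
  constructor
  · rintro ⟨s, hs, t, ht, rfl⟩
    change (0 ≤ B.xc (B.point s t) ∧ B.xc (B.point s t) ≤ _) ∧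
      0 ≤ B.yc (B.point s t) ∧ B.yc (B.point s t) ≤ _
    simpa using ⟨hs, ht⟩
  · rintro ⟨hs, ht⟩
    exact ⟨B.xc p, hs, B.yc p, ht, (B.point_xc_yc p).symm⟩

@[fun_prop] theorem continuous_xc (B : Building) : Continuous B.xc := by
  unfold xc; fun_prop

@[fun_prop] theorem continuous_yc (B : Building) : Continuous B.yc := by
  unfold yc; fun_prop

theorem isClosed_base (B : Building) : IsClosed B.base := by
  have : B.base = B.xc ⁻¹' Set.Icc 0 B.length ∩ B.yc ⁻¹' Set.Icc 0 B.width := by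
    ext p; exact B.mem_base p
  rw [this]
  exact (isClosed_Icc.preimage B.continuous_xc).inter (isClosed_Icc.preimage B.continuous_yc)

theorem mem_interior_base (B : Building) {p : ℝ × ℝ} (hx : B.xc p ∈ Set.Ioo 0 B.length)
    (hy : B.yc p ∈ Set.Ioo 0 B.width) : p ∈ interior B.base := by
  refine mem_interior.2 ⟨B.xc ⁻¹' Set.Ioo 0 B.length ∩ B.yc ⁻¹' Set.Ioo 0 B.width, ?_, ?_,
    hx, hy⟩
  · rintro q ⟨hx, hy⟩
    exact (B.mem_base q).2 ⟨⟨hx.1.le, hx.2.le⟩, hy.1.le, hy.2.le⟩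
  · exact (isOpen_Ioo.preimage B.continuous_xc).inter (isOpen_Ioo.preimage B.continuous_yc)

/-- The building blocks the view from `p` to `q` in the ground plane. -/
def Blocks (B : Building) (p q : ℝ × ℝ) : Prop :=
  ∃ t ∈ Set.Ioo (0 : ℝ) 1, (1 - t) • p + t • q ∈ interior B.base

/-- Blocking is an open condition on the target, so it can be checked at a wall midpoint and
transferred to nearby ground points. -/
theorem Blocks.eventually {B : Building} {p q : ℝ × ℝ} (h : B.Blocks p q) :
    ∀ᶠ r in 𝓝 q, B.Blocks p r := by
  obtain ⟨t, ht, hq⟩ := h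
  have hc : Continuous fun r : ℝ × ℝ => (1 - t) • p + t • r := by fun_prop
  filter_upwards [hc.continuousAt.eventually_mem (isOpen_interior.mem_nhds hq)] with r hr
  exact ⟨t, ht, hr⟩

theorem xc_comb (B : Building) (t : ℝ) (p q : ℝ × ℝ) :
    B.xc ((1 - t) • p + t • q) = (1 - t) * B.xc p + t * B.xc q := by
  simp [xc]; ring

theorem yc_comb (B : Building) (t : ℝ) (p q : ℝ × ℝ) :
    B.yc ((1 - t) • p + t • q) = (1 - t) * B.yc p + t * B.yc q := by
  simp [yc]; ring

theorem blocks_of_coords (B : Building) {p q : ℝ × ℝ} {t : ℝ} (ht : t ∈ Set.Ioo (0 : ℝ) 1)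
    (hx : (1 - t) * B.xc p + t * B.xc q ∈ Set.Ioo 0 B.length)
    (hy : (1 - t) * B.yc p + t * B.yc q ∈ Set.Ioo 0 B.width) : B.Blocks p q :=
  ⟨t, ht, B.mem_interior_base (by rwa [xc_comb]) (by rwa [yc_comb])⟩

/-- A point above the roof line is separated by the building from a point in the shadow below. -/
theorem blocks_of_above_of_below (B : Building) {p q : ℝ × ℝ}
    (hpx : B.xc p ∈ Set.Icc 0 B.length) (hpy : B.width ≤ B.yc p)
    (hqx : B.xc q ∈ Set.Ioo 0 B.length) (hqy : B.yc q < 0) : B.Blocks p q := by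
  have hw := B.width_pos
  have hd : 0 < B.yc p - B.yc q := by linarith
  -- The parameter at which the line of sight crosses the midline of the rectangle.
  set t := (B.yc p - B.width / 2) / (B.yc p - B.yc q) with ht
  have ht0 : 0 < t := div_pos (by linarith) hd
  have ht1 : t < 1 := (div_lt_one hd).2 (by linarith)
  have hm : t * (B.yc p - B.yc q) = B.yc p - B.width / 2 := div_mul_cancel₀ _ hd.ne'
  refine B.blocks_of_coords ⟨ht0, ht1⟩ ⟨?_, ?_⟩ ⟨by linarith, by linarith⟩
  · have := mul_nonneg (sub_nonneg.2 ht1.le) hpx.1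
    have := mul_pos ht0 hqx.1
    linarith
  · have := mul_le_mul_of_nonneg_left hpx.2 (sub_nonneg.2 ht1.le)
    have := mul_lt_mul_of_pos_left hqx.2 ht0
    linarith

/-- A point beside the building is separated by it from a point in the shadow below, if the line
of sight enters through the side wall. -/
theorem blocks_of_beside_of_below (B : Building) {p q : ℝ × ℝ}
    (hpx : B.length < B.xc p) (hpy : B.yc p < B.width)
    (hqx : B.xc q ∈ Set.Ioo 0 B.length) (hqy : B.yc q < 0)
    (h : 0 < B.yc p * (B.length - B.xc q) + B.yc q * (B.xc p - B.length)) : B.Blocks p q := by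
  have hd : 0 < B.xc p - B.xc q := by linarith [hqx.2]
  -- At `t` the line crosses the `forward` wall; `h` says that it does so at positive `yc`. A
  -- slightly larger parameter is then interior.
  set t := (B.xc p - B.length) / (B.xc p - B.xc q) with ht
  have ht0 : 0 < t := div_pos (by linarith) hd
  have ht1 : t < 1 := (div_lt_one hd).2 (by linarith [hqx.2])
  have hm : t * (B.xc p - B.xc q) = B.xc p - B.length := div_mul_cancel₀ _ hd.ne'
  have hX : (1 - t) * B.xc p + t * B.xc q = B.length := by linarith
  have hY : 0 < (1 - t) * B.yc p + t * B.yc q := by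
    have : (B.xc p - B.xc q) * ((1 - t) * B.yc p + t * B.yc q) =
        B.yc p * (B.length - B.xc q) + B.yc q * (B.xc p - B.length) := by
      linear_combination (B.yc q - B.yc p) * hm
    exact pos_of_mul_pos_right (this ▸ h) hd.le
  have hY' : (1 - t) * B.yc p + t * B.yc q < B.width := by
    have h1 := mul_lt_mul_of_pos_left hpy (sub_pos.2 ht1)
    have h2 := mul_lt_mul_of_pos_left hqy ht0
    have h3 := mul_pos ht0 B.width_pos
    linarith
  have cx : Continuous fun s : ℝ => (1 - s) * B.xc p + s * B.xc q := by fun_prop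
  have cy : Continuous fun s : ℝ => (1 - s) * B.yc p + s * B.yc q := by fun_prop
  have e1 : ∀ᶠ s in 𝓝[>] t, s < 1 :=
    (eventually_lt_nhds ht1).filter_mono nhdsWithin_le_nhds
  have e2 : ∀ᶠ s in 𝓝[>] t, 0 < (1 - s) * B.xc p + s * B.xc q :=
    (cx.continuousAt.eventually_const_lt (B.length_pos.trans_eq hX.symm)).filter_mono
      nhdsWithin_le_nhds
  have e3 : ∀ᶠ s in 𝓝[>] t, (1 - s) * B.yc p + s * B.yc q ∈ Set.Ioo 0 B.width :=
    (cy.continuousAt.eventually_mem (isOpen_Ioo.mem_nhds ⟨hY, hY'⟩)).filter_mono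
      nhdsWithin_le_nhds
  obtain ⟨s, h1, h2, h3, h4⟩ :=
    (e1.and (e2.and (e3.and (self_mem_nhdsWithin (s := Set.Ioi t))))).exists
  have h4 : t < s := h4
  refine B.blocks_of_coords ⟨ht0.trans h4, h1⟩ ⟨h2, ?_⟩ h3
  have := mul_pos (sub_pos.2 h4) hd
  linarith

/-- The signed distance of a point to the line of a wall, positive on the side of the building. -/
def depth (B : Building) (p : ℝ × ℝ) : Facing → ℝ
  | .forward => B.length - B.xc p
  | .backward => B.xc p
  | .left => B.width - B.yc p
  | .right => B.yc p

/-- The point at horizontal distance `ε` in front of the middle of a wall. -/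
noncomputable def front (B : Building) (ε : ℝ) : Facing → ℝ × ℝ
  | .forward => B.point (B.length + ε) (B.width / 2)
  | .backward => B.point (-ε) (B.width / 2)
  | .left => B.point (B.length / 2) (B.width + ε)
  | .right => B.point (B.length / 2) (-ε)

theorem continuous_front (B : Building) (f : Facing) : Continuous fun ε => B.front ε f := by
  cases f <;> simp only [front, point] <;> fun_prop

theorem front_zero_mem_base (B : Building) (f : Facing) : B.front 0 f ∈ B.base := by
  have := B.length_pos
  have := B.width_pos
  rw [mem_base]
  cases f <;> simp only [front, xc_point, yc_point] <;> refine ⟨⟨?_, ?_⟩, ?_, ?_⟩ <;> linarith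

theorem front_notMem_base (B : Building) {ε : ℝ} (hε : 0 < ε) (f : Facing) :
    B.front ε f ∉ B.base := by
  rw [mem_base]
  cases f <;> simp only [front, xc_point, yc_point] <;> rintro ⟨⟨_, _⟩, _, _⟩ <;> linarith

/-- Just before reaching the midpoint of the top edge from strictly below its line, a segment is
inside the rectangle. Swapping or reflecting coordinates gives all four walls. -/
theorem exists_convexComb_mem {x y l w : ℝ} (hl : 0 < l) (hw : 0 < w) (hy : y < w) :
    ∃ t ∈ Set.Ioo (0 : ℝ) 1, (1 - t) * x + t * (l / 2) ∈ Set.Ioo 0 l ∧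
      (1 - t) * y + t * w ∈ Set.Ioo 0 w := by
  have cx : Continuous fun s : ℝ => (1 - s) * x + s * (l / 2) := by fun_prop
  have cy : Continuous fun s : ℝ => (1 - s) * y + s * w := by fun_prop
  have e1 : ∀ᶠ s in 𝓝[<] (1 : ℝ), 0 < s :=
    (eventually_gt_nhds one_pos).filter_mono nhdsWithin_le_nhds
  have e2 : ∀ᶠ s in 𝓝[<] (1 : ℝ), (1 - s) * x + s * (l / 2) ∈ Set.Ioo 0 l :=
    (cx.continuousAt.eventually_mem (isOpen_Ioo.mem_nhds ⟨by linarith, by linarith⟩)).filter_mono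
      nhdsWithin_le_nhds
  have e3 : ∀ᶠ s in 𝓝[<] (1 : ℝ), 0 < (1 - s) * y + s * w :=
    (cy.continuousAt.eventually_const_lt (by linarith)).filter_mono nhdsWithin_le_nhds
  obtain ⟨s, h1, h2, h3, h4⟩ :=
    (e1.and (e2.and (e3.and (self_mem_nhdsWithin (s := Set.Iio (1 : ℝ)))))).exists
  have h4 : s < 1 := h4
  refine ⟨s, ⟨h1, h4⟩, h2, h3, ?_⟩
  have := mul_pos (sub_pos.2 h4) (sub_pos.2 hy)
  linarith

/-- From behind the line of a wall, the building hides the wall. -/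
theorem blocks_front_zero (B : Building) {p : ℝ × ℝ} {f : Facing} (h : 0 < B.depth p f) :
    B.Blocks p (B.front 0 f) := by
  have hl := B.length_pos
  have hw := B.width_pos
  cases f <;> simp only [depth] at h
  · obtain ⟨t, ht, h1, h2⟩ := exists_convexComb_mem (x := B.yc p) hw hl (sub_pos.1 h)
    exact B.blocks_of_coords ht (by simpa [front] using h2) (by simpa [front] using h1)
  · obtain ⟨t, ht, h1, h2⟩ := exists_convexComb_mem (x := B.yc p) (y := B.length - B.xc p) hw hl
      (by linarith)
    refine B.blocks_of_coords ht ?_ (by simpa [front] using h1)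
    simp only [front, xc_point, Set.mem_Ioo] at h2 ⊢
    constructor <;> linarith
  · obtain ⟨t, ht, h1, h2⟩ := exists_convexComb_mem (x := B.xc p) hl hw (sub_pos.1 h)
    exact B.blocks_of_coords ht (by simpa [front] using h1) (by simpa [front] using h2)
  · obtain ⟨t, ht, h1, h2⟩ := exists_convexComb_mem (x := B.xc p) (y := B.width - B.yc p) hl hw
      (by linarith)
    refine B.blocks_of_coords ht (by simpa [front] using h1) ?_
    simp only [front, yc_point, Set.mem_Ioo] at h2 ⊢
    constructor <;> linarith

end Building

/-! ### Placing the next bar of the tower -/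

/-- A building of unit width and height, with the dimensions of a box behind its `right` wall in
which all earlier buildings are to be found. -/
structure Stage where
  bar : Building
  width_eq : bar.width = 1
  height_eq : bar.height = 1
  gap : ℝ
  reach : ℝ
  gap_pos : 0 < gap
  reach_pos : 0 < reach

namespace Stage

/-- The box behind the `right` wall. -/
def core (S : Stage) : Set (ℝ × ℝ) :=
  {p | (S.gap ≤ S.bar.xc p ∧ S.bar.xc p ≤ S.bar.length - S.gap) ∧
    -S.reach ≤ S.bar.yc p ∧ S.bar.yc p ≤ -S.gap}

/-- The relation between consecutive stages. -/
structure Precedes (S T : Stage) : Prop where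
  base_subset : S.bar.base ⊆ T.core
  core_subset : S.core ⊆ T.core
  -- The start corner is on the outer side of the `left` wall line of `S.bar` only, the finish
  -- corner of the `forward` wall line only.
  start_xc : S.bar.xc (T.bar.point 0 0) ∈ Set.Ioo 0 S.bar.length
  start_yc : 1 < S.bar.yc (T.bar.point 0 0)
  finish_xc : S.bar.length < S.bar.xc (T.bar.point T.bar.length 0)
  finish_yc : S.bar.yc (T.bar.point T.bar.length 0) ∈ Set.Ioo 0 1
  -- The hypothesis of `blocks_of_beside_of_below`: `S.bar` hides its core from the finish corner.
  shield : ∀ q ∈ S.core, 0 < S.bar.yc (T.bar.point T.bar.length 0) * (S.bar.length - S.bar.xc q) +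
    S.bar.yc q * (S.bar.xc (T.bar.point T.bar.length 0) - S.bar.length)

/-- In the frame of `B`, the new lower wall starts at `(n, 1 + a)` and descends with direction `(c,
-s)`. It passes just above the corner `(l, 1)`, meets height `1` at `(l + n, 1)`, and continues for
a further length `M * s`. For small `s` the finish corner is so close to `(l, 1)` that `B` still
shields its core. -/
theorem exists_precedes (S : Stage) : ∃ T : Stage, S.Precedes T := by
  obtain ⟨B, hw, hh, g, C, hg, hC⟩ := S
  obtain ⟨l, hl⟩ : ∃ l, l = B.length := ⟨_, rfl⟩
  have hl0 : 0 < l := hl ▸ B.length_pos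
  -- The tilt shifts a point at depth `C` forward by about `s * C`; the extra length `M * s` covers
  -- this with margin `s`.
  obtain ⟨M, hM⟩ : ∃ M, M = C + 2 + l := ⟨_, rfl⟩
  have hM0 : 0 < M := by linarith
  -- `s` is the sine of the tilt. The third bound keeps the finish corner above height `1 / 2`; the
  -- last one gives `shield`.
  obtain ⟨s, hs0, hs1, hs2, hs3⟩ :
      ∃ s : ℝ, 0 < s ∧ s < 1 / 2 ∧ s * M < 1 / 2 ∧ s * (C * (l + M)) < g / 2 := by
    have e (K δ : ℝ) (hδ : 0 < δ) : ∀ᶠ s in 𝓝[>] (0 : ℝ), s * K < δ := by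
      have : Continuous fun s : ℝ => s * K := by fun_prop
      exact (this.continuousAt.eventually_lt_const (by simpa using hδ)).filter_mono
        nhdsWithin_le_nhds
    obtain ⟨s, h1, h2, h3, h4⟩ := ((e 1 (1 / 2) (by norm_num)).and ((e M (1 / 2) (by norm_num)).and
      ((e (C * (l + M)) (g / 2) (by linarith)).and
        (self_mem_nhdsWithin (s := Set.Ioi (0 : ℝ)))))).exists
    exact ⟨s, h4, by linarith, h2, h3⟩
  obtain ⟨c, hc⟩ : ∃ c, c = √(1 - s ^ 2) := ⟨_, rfl⟩
  have hcs : c ^ 2 + s ^ 2 = 1 := by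
    rw [hc, Real.sq_sqrt (by nlinarith)]; ring
  have hc1 : c ≤ 1 := by nlinarith
  have hc0 : 1 / 2 < c := by
    have : 0 ≤ c := hc ▸ Real.sqrt_nonneg _
    nlinarith
  obtain ⟨i, hi⟩ : ∃ i, i = 1 / c := ⟨_, rfl⟩
  have hic : c * i = 1 := by rw [hi]; field_simp
  have hi1 : 1 ≤ i := by nlinarith
  have hi2 : i < 2 := by nlinarith
  obtain ⟨a, ha⟩ : ∃ a, a = s * l * i := ⟨_, rfl⟩
  have hsl : 0 < s * l := mul_pos hs0 hl0
  have ha0 : 0 < a := by rw [ha]; positivity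
  have hal : a < l := by
    have : s * i < 1 := by
      have := mul_lt_mul_of_pos_left hi2 hs0
      linarith
    have := mul_lt_mul_of_pos_right this hl0
    rw [ha]; linarith
  have hca : c * a = s * l := by rw [ha]; linear_combination s * l * hic
  -- With this offset the corner `(0, 1)` has new first coordinate at least `n`, while `(l, 1)` has
  -- new second coordinate `-(s * n)`.
  obtain ⟨n, hn⟩ : ∃ n, n = s * a / 2 := ⟨_, rfl⟩
  have hn0 : 0 < n := by rw [hn]; positivity
  have hnl : n < s * l := by
    have := mul_lt_mul_of_pos_left hal hs0
    rw [hn]; linarith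
  obtain ⟨l', hl'⟩ : ∃ l', l' = l * i + M * s := ⟨_, rfl⟩
  have hl'0 : 0 < l' := by rw [hl']; positivity
  have hu := B.dir_unit
  let B' : Building :=
    { corner := B.point n (1 + a)
      dir := (c * B.dir.1 + s * B.dir.2, c * B.dir.2 - s * B.dir.1)
      length := l'
      width := 1
      height := 1
      dir_unit := by
        dsimp only
        linear_combination (c ^ 2 + s ^ 2) * hu + hcs
      length_pos := hl'0
      width_pos := one_pos
      height_pos := one_pos }
  have hX (p) : B'.xc p = c * (B.xc p - n) - s * (B.yc p - 1 - a) := by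
    simp only [B', Building.xc, Building.yc, Building.point_fst, Building.point_snd]
    linear_combination (- c * n + s * (1 + a)) * hu
  have hY (p) : B'.yc p = s * (B.xc p - n) + c * (B.yc p - 1 - a) := by
    simp only [B', Building.xc, Building.yc, Building.point_fst, Building.point_snd]
    linear_combination (- s * n - c * (1 + a)) * hu
  have hx (x y) : B.xc (B'.point x y) = n + c * x + s * y := by
    have h1 := hX (B'.point x y)
    have h2 := hY (B'.point x y)
    rw [Building.xc_point] at h1
    rw [Building.yc_point] at h2
    linear_combination (-c) * h1 - s * h2 - (B.xc (B'.point x y) - n) * hcs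
  have hy (x y) : B.yc (B'.point x y) = 1 + a - s * x + c * y := by
    have h1 := hX (B'.point x y)
    have h2 := hY (B'.point x y)
    rw [Building.xc_point] at h1
    rw [Building.yc_point] at h2
    linear_combination s * h1 - c * h2 - (B.yc (B'.point x y) - 1 - a) * hcs
  have hsn : 0 < s * n := by positivity
  let T : Stage := ⟨B', rfl, rfl, min (s * n) (min s n), s * n + (C + 1 + a),
    by positivity, by positivity⟩
  -- This rectangle contains both the old bar and the old core.
  have key (p) (h1 : 0 ≤ B.xc p) (h2 : B.xc p ≤ l) (h3 : -C ≤ B.yc p) (h4 : B.yc p ≤ 1) :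
      p ∈ T.core := by
    have hg1 : min (s * n) (min s n) ≤ s * n := min_le_left _ _
    have hg2 : min (s * n) (min s n) ≤ s := (min_le_right _ _).trans (min_le_left _ _)
    have hg3 : min (s * n) (min s n) ≤ n := (min_le_right _ _).trans (min_le_right _ _)
    have hc' : 0 < c := by linarith
    have e1 := mul_nonneg hc'.le h1
    have e2 := mul_le_mul_of_nonneg_left h2 hc'.le
    have e3 := mul_nonneg hs0.le (sub_nonneg.2 h4)
    have e4 := mul_le_mul_of_nonneg_left h3 hs0.le
    have e5 := mul_nonneg hs0.le h1
    have e6 := mul_le_mul_of_nonneg_left h2 hs0.le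
    have e7 := mul_nonneg hc'.le (sub_nonneg.2 h4)
    have e8 := mul_le_mul_of_nonneg_left hc1 hn0.le
    have e9 := mul_pos hc' hn0
    have e10 : c * l ≤ l * i := by
      rw [mul_comm c]; exact mul_le_mul_of_nonneg_left (by linarith) hl0.le
    have e11 := mul_lt_mul_of_pos_left hal hs0
    have e12 : c * (C + 1 + a) ≤ C + 1 + a :=
      mul_le_of_le_one_left (by linarith) hc1
    have e13 := mul_le_mul_of_nonneg_left h3 hc'.le
    refine ⟨⟨?_, ?_⟩, ?_, ?_⟩
    · change min (s * n) (min s n) ≤ B'.xc p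
      rw [hX]; linarith
    · change B'.xc p ≤ l' - min (s * n) (min s n)
      rw [hX, hl', hM]; linarith
    · change -(s * n + (C + 1 + a)) ≤ B'.yc p
      rw [hY]; linarith
    · change B'.yc p ≤ -min (s * n) (min s n)
      rw [hY]; linarith
  have hfx : B.xc (B'.point l' 0) = l + (n + c * M * s) := by
    rw [hx, hl']; linear_combination l * hic
  have hfy : B.yc (B'.point l' 0) = 1 - M * s * s := by
    rw [hy, hl', ha]; ring
  have hMs : M * s * s < 1 / 2 := by
    have := mul_lt_mul_of_pos_left hs2 hs0
    linarith
  have hMs0 : 0 < M * s * s := by positivity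
  have hcM : 0 < c * M * s := by positivity
  refine ⟨T, ⟨?_, ?_, ?_, ?_, ?_, ?_, ?_⟩⟩
  · intro p hp
    obtain ⟨⟨h1, h2⟩, h3, h4⟩ := (B.mem_base p).1 hp
    exact key p h1 (hl ▸ h2) (by linarith) (hw ▸ h4)
  · rintro p ⟨⟨h1, h2⟩, h3, h4⟩
    simp only [← hl] at h1 h2 h3 h4
    exact key p (by linarith) (by linarith) h3 (by linarith)
  · change B.xc (B'.point 0 0) ∈ Set.Ioo 0 B.length
    rw [hx, ← hl]
    have := mul_lt_mul_of_pos_right hs1 hl0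
    constructor <;> linarith
  · change 1 < B.yc (B'.point 0 0)
    rw [hy]; linarith
  · change B.length < B.xc (B'.point l' 0)
    rw [hfx]; linarith
  · change B.yc (B'.point l' 0) ∈ Set.Ioo 0 1
    rw [hfy]; constructor <;> linarith
  · rintro q ⟨⟨h1, h2⟩, h3, h4⟩
    change 0 < B.yc (B'.point l' 0) * (B.length - B.xc q) +
      B.yc q * (B.xc (B'.point l' 0) - B.length)
    simp only [← hl] at h1 h2 h3 h4
    rw [hfx, hfy, ← hl]
    have f1 : 1 / 2 * g ≤ (1 - M * s * s) * (l - B.xc q) :=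
      mul_le_mul (by linarith) (by linarith) hg.le (by linarith)
    have f2 := mul_le_mul_of_nonneg_right h3 (show 0 ≤ n + c * M * s by positivity)
    have f3 : c * M * s ≤ M * s := by
      rw [mul_assoc]; exact mul_le_of_le_one_left (by positivity) hc1
    have f4 : C * (n + c * M * s) ≤ C * (s * l + M * s) :=
      mul_le_mul_of_nonneg_left (by linarith) hC.le
    linarith

end Stage

namespace Building

theorem abs_le_of_mem_base (B : Building) {p : ℝ × ℝ} (hp : p ∈ B.base) :
    |p.1| ≤ |B.corner.1| + |B.corner.2| + B.length + B.width ∧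
      |p.2| ≤ |B.corner.1| + |B.corner.2| + B.length + B.width := by
  obtain ⟨⟨h1, h2⟩, h3, h4⟩ := (B.mem_base p).1 hp
  have hu := B.dir_unit
  have hd1 : |B.dir.1| ≤ 1 := abs_le_one_iff_mul_self_le_one.2 (by nlinarith [sq_nonneg B.dir.2])
  have hd2 : |B.dir.2| ≤ 1 := abs_le_one_iff_mul_self_le_one.2 (by nlinarith [sq_nonneg B.dir.1])
  have bound {x l d : ℝ} (hx : 0 ≤ x) (hl : x ≤ l) (hd : |d| ≤ 1) : |x * d| ≤ l := by
    rw [abs_mul, abs_of_nonneg hx]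
    exact (mul_le_of_le_one_right hx hd).trans hl
  have e1 := abs_nonneg B.corner.1
  have e2 := abs_nonneg B.corner.2
  rw [← B.point_xc_yc p, point_fst, point_snd]
  constructor
  · have := abs_sub (B.corner.1 + B.xc p * B.dir.1) (B.yc p * B.dir.2)
    have := abs_add_le B.corner.1 (B.xc p * B.dir.1)
    linarith [bound h1 h2 hd1, bound h3 h4 hd2]
  · have := abs_add_le (B.corner.2 + B.xc p * B.dir.2) (B.yc p * B.dir.1)
    have := abs_add_le B.corner.2 (B.xc p * B.dir.2)
    linarith [bound h1 h2 hd2, bound h3 h4 hd1]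

theorem baseVertex_eq_point (B : Building) (i j : Bool) :
    B.baseVertex i j = B.point (if i then B.length else 0) (if j then B.width else 0) := rfl

theorem baseVertex_mem_base (B : Building) (i j : Bool) : B.baseVertex i j ∈ B.base := by
  have := B.length_pos
  have := B.width_pos
  rw [baseVertex_eq_point, mem_base, xc_point, yc_point]
  cases i <;> cases j <;> simp <;> constructor <;> linarith

/-- How far `q` is in front of `p`, for an observer facing in a given direction. -/
def ahead (B : Building) (p q : ℝ × ℝ) : Facing → ℝ
  | .forward => B.xc q - B.xc p
  | .backward => B.xc p - B.xc q
  | .left => B.yc q - B.yc p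
  | .right => B.yc p - B.yc q

theorem continuous_ahead (B : Building) (p : ℝ × ℝ) (f : Facing) :
    Continuous fun q => B.ahead p q f := by
  cases f <;> simp only [ahead] <;> fun_prop

end Building

/-! ### Visibility of ground points near walls -/

namespace City

variable {k : ℕ}

theorem Sees.ahead_nonneg {C : City k} {g : Guard k} {q : (ℝ × ℝ) × ℝ} (h : C.Sees g q) :
    0 ≤ (C.building g.index).ahead (C.position g).1 q.1 g.facing := by
  have h1 : q ∈ C.vision g := h.1
  rw [vision, Set.mem_ofPred_eq] at h1
  convert h1 using 1
  cases g.facing <;>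
    simp [Building.ahead, Building.facingVec, Building.xc, Building.yc, Building.perp] <;> ring

/-- Between a guard at altitude `1` and the ground, altitudes lie strictly between `0` and `1`; with
all heights `1`, visibility becomes a planar question. -/
theorem Sees.not_blocks {C : City k} (hC : ∀ i, (C.building i).height = 1) {g : Guard k}
    {q : ℝ × ℝ} (h : C.Sees g (q, 0)) (i : Fin k) :
    ¬ (C.building i).Blocks (C.position g).1 q := by
  rintro ⟨t, ht, hq⟩
  have h1 : ((1 - t) • (C.position g).1 + t • q, 1 - t) ∈ segment ℝ (C.position g) (q, 0) := by
    refine ⟨1 - t, t, by linarith [ht.2], ht.1.le, by ring, ?_⟩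
    have : (C.position g).2 = 1 := hC _
    ext <;> simp [this]
  have h2 : ((1 - t) • (C.position g).1 + t • q, 1 - t) ∈ interior (C.building i).solid := by
    rw [Building.solid, interior_prod_eq, interior_Icc, hC]
    exact ⟨hq, by linarith [ht.2], by linarith [ht.1]⟩
  exact Set.disjoint_left.1 (h.2 i) h1 h2

/-- A ground point just in front of a wall has to be guarded. -/
theorem eventually_front_mem_surface (C : City k) (i : Fin k) (f : Facing) :
    ∀ᶠ ε in 𝓝[>] (0 : ℝ), ((C.building i).front ε f, (0 : ℝ)) ∈ C.surface := by
  have hc := ((C.building i).continuous_front f).continuousAt (x := 0)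
  have hb := (C.building i).front_zero_mem_base f
  have e1 : ∀ᶠ ε in 𝓝[>] (0 : ℝ),
      (C.building i).front ε f ∈ Set.Ioo C.lo.1 C.hi.1 ×ˢ Set.Ioo C.lo.2 C.hi.2 :=
    (hc.eventually_mem ((isOpen_Ioo.prod isOpen_Ioo).mem_nhds
      (C.base_subset i hb))).filter_mono nhdsWithin_le_nhds
  have e2 : ∀ᶠ ε in 𝓝[>] (0 : ℝ), ∀ j, j ≠ i →
      (C.building i).front ε f ∈ (C.building j).baseᶜ := by
    rw [eventually_all]
    intro j
    by_cases hj : j = i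
    · simp [hj]
    · filter_upwards [(hc.eventually_mem ((C.building j).isClosed_base.isOpen_compl.mem_nhds
        (Set.disjoint_right.1 (C.disjoint j i hj) hb))).filter_mono nhdsWithin_le_nhds] with ε hε _
        using hε
  filter_upwards [e1, e2, self_mem_nhdsWithin] with ε h1 h2 h3
  refine Or.inl (Or.inl ⟨⟨⟨Set.Ioo_subset_Icc_self h1.1, Set.Ioo_subset_Icc_self h1.2⟩, ?_⟩, rfl⟩)
  rw [Set.mem_iUnion]
  rintro ⟨j, hj⟩
  by_cases hji : j = i
  · subst hji
    exact Building.front_notMem_base _ h3 f (interior_subset hj)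
  · exact h2 j hji (interior_subset hj)

theorem eventually_not_sees_of_blocks {C : City k} (hC : ∀ i, (C.building i).height = 1)
    {g : Guard k} {i j : Fin k} {f : Facing}
    (h : (C.building j).Blocks (C.position g).1 ((C.building i).front 0 f)) :
    ∀ᶠ ε in 𝓝[>] (0 : ℝ), ¬ C.Sees g ((C.building i).front ε f, 0) := by
  have hc := ((C.building i).continuous_front f).continuousAt (x := 0)
  filter_upwards [(hc.eventually h.eventually).filter_mono nhdsWithin_le_nhds] with ε hε hs
  exact hs.not_blocks hC j hε

theorem eventually_not_sees_of_depth {C : City k} (hC : ∀ i, (C.building i).height = 1)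
    {g : Guard k} {i : Fin k} {f : Facing}
    (h : 0 < (C.building i).depth (C.position g).1 f) :
    ∀ᶠ ε in 𝓝[>] (0 : ℝ), ¬ C.Sees g ((C.building i).front ε f, 0) :=
  eventually_not_sees_of_blocks hC ((C.building i).blocks_front_zero h)

theorem eventually_not_sees_of_ahead {C : City k} {g : Guard k} {i : Fin k} {f : Facing}
    (h : (C.building g.index).ahead (C.position g).1 ((C.building i).front 0 f) g.facing < 0) :
    ∀ᶠ ε in 𝓝[>] (0 : ℝ), ¬ C.Sees g ((C.building i).front ε f, 0) := by
  have hc := (((C.building g.index).continuous_ahead (C.position g).1 g.facing).comp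
    ((C.building i).continuous_front f)).continuousAt (x := 0)
  filter_upwards [(hc.eventually_lt_const h).filter_mono nhdsWithin_le_nhds] with ε hε hs
  exact absurd hs.ahead_nonneg (not_le.2 hε)

end City

/-- The only wall of its own building whose `front` a guard can see. -/
def Guard.ownWall {k : ℕ} (g : Guard k) : Facing :=
  match g.i, g.j, g.facing with
  | false, true, .left | false, true, .forward => .left
  | false, true, .backward | false, true, .right => .backward
  | true, true, .left | true, true, .backward => .left
  | true, true, .forward | true, true, .right => .forward
  | false, false, .left | false, false, .backward => .backward
  | false, false, .right | false, false, .forward => .right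
  | true, false, .left | true, false, .forward => .forward
  | true, false, .right | true, false, .backward => .right

theorem City.eventually_not_sees_own {k : ℕ} {C : City k} (hC : ∀ i, (C.building i).height = 1)
    {g : Guard k} {f : Facing} (hf : f ≠ g.ownWall) :
    ∀ᶠ ε in 𝓝[>] (0 : ℝ), ¬ C.Sees g ((C.building g.index).front ε f, 0) := by
  by_cases hd : 0 < (C.building g.index).depth (C.position g).1 f
  · exact eventually_not_sees_of_depth hC hd
  -- Only the two walls at the guard's vertex remain. Here `ε > 0` is essential: a closed half-plane
  -- may contain the wall itself but not the points in front of it.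
  filter_upwards [self_mem_nhdsWithin] with ε hε hs
  have hε : 0 < ε := hε
  have h := hs.ahead_nonneg
  have hl := (C.building g.index).length_pos
  have hw := (C.building g.index).width_pos
  obtain ⟨n, i, j, a⟩ := g
  simp only [position, Building.topVertex, Building.baseVertex_eq_point] at h hd
  rcases i <;> rcases j <;> rcases a <;> rcases f <;>
    simp [Building.ahead, Building.front, Building.depth, Guard.ownWall] at h hd hf <;>
    linarith

/-! ### The infinite tower and its finite cities -/

namespace Stage

theorem bar_base_subset_core {S : ℕ → Stage} (hS : ∀ n, (S n).Precedes (S (n + 1))) {m n : ℕ}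
    (h : m < n) : (S m).bar.base ⊆ (S n).core := by
  induction n, h using Nat.le_induction with
  | base => exact (hS m).base_subset
  | succ n _ ih => exact ih.trans (hS n).core_subset

theorem disjoint_core_base (S : Stage) : Disjoint S.core S.bar.base := by
  rw [Set.disjoint_left]
  rintro p ⟨_, _, h⟩ hp
  linarith [((S.bar.mem_base p).1 hp).2.1, S.gap_pos]

theorem xc_mem_of_mem_core {S : Stage} {p : ℝ × ℝ} (hp : p ∈ S.core) :
    S.bar.xc p ∈ Set.Ioo 0 S.bar.length :=
  ⟨S.gap_pos.trans_le hp.1.1, by linarith [hp.1.2, S.gap_pos]⟩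

theorem yc_neg_of_mem_core {S : Stage} {p : ℝ × ℝ} (hp : p ∈ S.core) : S.bar.yc p < 0 := by
  linarith [hp.2.2, S.gap_pos]

theorem exists_sequence : ∃ S : ℕ → Stage, ∀ n, (S n).Precedes (S (n + 1)) := by
  choose next hnext using exists_precedes
  let S₀ : Stage :=
    { bar :=
        { corner := 0, dir := (1, 0), length := 1, width := 1, height := 1
          dir_unit := by norm_num
          length_pos := one_pos
          width_pos := one_pos
          height_pos := one_pos }
      width_eq := rfl
      height_eq := rfl
      gap := 1
      reach := 1
      gap_pos := one_pos
      reach_pos := one_pos }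
  exact ⟨fun n => next^[n] S₀, fun n => by
    simpa only [Function.iterate_succ_apply'] using hnext (next^[n] S₀)⟩

/-- The city formed by the first `k` bars of a sequence of stages. -/
theorem exists_city {S : ℕ → Stage} (hS : ∀ n, (S n).Precedes (S (n + 1))) (k : ℕ) :
    ∃ C : City k, ∀ i, C.building i = (S i).bar := by
  let r (i : Fin k) : ℝ := |(S i).bar.corner.1| + |(S i).bar.corner.2| + (S i).bar.length +
    (S i).bar.width
  have hr (i : Fin k) : 0 ≤ r i := by
    have := (S i).bar.length_pos
    have := (S i).bar.width_pos
    positivity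
  -- The `1` makes the bounds strict, and the region nondegenerate when `k = 0`.
  let R : ℝ := 1 + ∑ i, r i
  have hR : 0 < R := by
    have := Finset.sum_nonneg fun i (_ : i ∈ Finset.univ) => hr i
    simp only [R]; linarith
  have hrR (i : Fin k) : r i < R := by
    have := Finset.single_le_sum (fun i _ => hr i) (Finset.mem_univ i)
    simp only [R]; linarith
  have hlt {i j : Fin k} (h : i < j) : Disjoint (S i).bar.base (S j).bar.base :=
    (disjoint_core_base _).mono_left (bar_base_subset_core hS h)
  exact ⟨{
    lo := (-R, -R)
    hi := (R, R)
    lo_lt_hi_fst := by dsimp only; linarith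
    lo_lt_hi_snd := by dsimp only; linarith
    building := fun i => (S i).bar
    base_subset := fun i p hp => by
      obtain ⟨h1, h2⟩ := (S i).bar.abs_le_of_mem_base hp
      exact ⟨abs_lt.1 (h1.trans_lt (hrR i)), abs_lt.1 (h2.trans_lt (hrR i))⟩
    disjoint := fun i j hij => (lt_or_gt_of_ne hij).elim hlt fun h => (hlt h).symm }, fun _ => rfl⟩

end Stage

/-! ### Each guard is responsible for at most one test wall -/

/-- The only wall assigned to a guard in a tower of bars: guards at the lower vertices of a bar
that turn away from its side wall are assigned a wall of the preceding bar. -/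
def Guard.watched {n : ℕ} (g : Guard (n + 1)) : Fin (n + 1) × Facing :=
  match g.index, g.ownWall with
  | ⟨m + 1, hm⟩, .right => (⟨m, by omega⟩, if g.i then .forward else .left)
  | m, f => (m, f)

theorem Guard.watched_of_ownWall_ne {n : ℕ} {g : Guard (n + 1)} (h : g.ownWall ≠ .right) :
    g.watched = (g.index, g.ownWall) := by
  unfold watched
  split
  · exact absurd ‹_› h
  · rfl

theorem Guard.watched_of_index_eq_zero {n : ℕ} {g : Guard (n + 1)} (h : g.index = 0) :
    g.watched = (g.index, g.ownWall) := by
  unfold watched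
  split
  · rename_i h' _
    rw [h] at h'
    exact absurd (congrArg Fin.val h') (Nat.succ_ne_zero _).symm
  · rfl

theorem Guard.watched_of_ownWall_eq {n m : ℕ} {g : Guard (n + 1)} (h : g.ownWall = .right)
    (hm : g.index.val = m + 1) :
    g.watched = (⟨m, by omega⟩, if g.i then .forward else .left) := by
  have : g.index = ⟨m + 1, hm ▸ g.index.2⟩ := Fin.ext hm
  unfold watched
  rw [this, h]

namespace City

variable {n : ℕ} {C : City (n + 1)} {S : ℕ → Stage}

/-- The guard stands in the core of the later bar, hence strictly behind the lines of all its walls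
but the `right` one. -/
theorem eventually_not_sees_later (hC : ∀ i, C.building i = (S i).bar)
    (hS : ∀ n, (S n).Precedes (S (n + 1))) {g : Guard (n + 1)} {i : Fin (n + 1)} {f : Facing}
    (hf : f ≠ .right) (hi : g.index < i) :
    ∀ᶠ ε in 𝓝[>] (0 : ℝ), ¬ C.Sees g ((C.building i).front ε f, 0) := by
  refine eventually_not_sees_of_depth (fun i => by rw [hC]; exact (S i).height_eq) ?_
  have hp : (C.position g).1 ∈ (S i).core :=
    Stage.bar_base_subset_core hS hi
      (by rw [← hC]; exact (C.building g.index).baseVertex_mem_base g.i g.j)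
  have h1 := Stage.xc_mem_of_mem_core hp
  have h2 := Stage.yc_neg_of_mem_core hp
  rw [hC]
  have := (S i).width_eq
  cases f <;> simp only [Building.depth]
  · linarith [h1.2]
  · exact h1.1
  · linarith
  · exact absurd rfl hf

theorem eventually_not_sees_earlier (hC : ∀ i, C.building i = (S i).bar)
    (hS : ∀ n, (S n).Precedes (S (n + 1))) {g : Guard (n + 1)} {i : Fin (n + 1)} {f : Facing}
    (hi : i < g.index) (hg : g.watched ≠ (i, f)) :
    ∀ᶠ ε in 𝓝[>] (0 : ℝ), ¬ C.Sees g ((C.building i).front ε f, 0) := by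
  have hh (i) : (C.building i).height = 1 := by rw [hC]; exact (S i).height_eq
  have hq : (C.building i).front 0 f ∈ (S i).bar.base := by
    rw [← hC]; exact (C.building i).front_zero_mem_base f
  have hqg := Stage.bar_base_subset_core hS hi hq
  have hqx := Stage.xc_mem_of_mem_core hqg
  have hqy := Stage.yc_neg_of_mem_core hqg
  obtain ⟨⟨m, hm⟩, a, b, d⟩ := g
  obtain ⟨l, rfl⟩ : ∃ l, m = l + 1 := Nat.exists_eq_add_one_of_ne_zero (by
    rintro rfl; exact absurd hi (Nat.not_lt_zero _))
  have hl : (S (l + 1)).bar.width = 1 := (S (l + 1)).width_eq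
  have hl' := (S (l + 1)).bar.length_pos
  cases b
  · have hil : i.val ≤ l := Nat.lt_succ_iff.1 hi
    have hp : (C.position ⟨⟨l + 1, hm⟩, a, false, d⟩).1 =
        (S (l + 1)).bar.point (if a then (S (l + 1)).bar.length else 0) 0 := by
      change (C.building ⟨l + 1, hm⟩).baseVertex a false = _
      rw [hC]; rfl
    have P := hS l
    have hw := (S l).width_eq
    -- Bars before the preceding one are hidden from both lower vertices by the preceding bar.
    rcases hil.lt_or_eq with hil | hil
    · refine eventually_not_sees_of_blocks (j := ⟨l, by omega⟩) hh ?_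
      have hql := Stage.bar_base_subset_core hS hil hq
      rw [hp, hC ⟨l, _⟩]
      cases a
      · exact (S l).bar.blocks_of_above_of_below ⟨P.start_xc.1.le, P.start_xc.2.le⟩
          (hw.trans_le P.start_yc.le) (Stage.xc_mem_of_mem_core hql)
          (Stage.yc_neg_of_mem_core hql)
      · exact (S l).bar.blocks_of_beside_of_below P.finish_xc (P.finish_yc.2.trans_eq hw.symm)
          (Stage.xc_mem_of_mem_core hql) (Stage.yc_neg_of_mem_core hql) (P.shield _ hql)
    · have hln : l < n + 1 := by omega
      obtain rfl : i = ⟨l, hln⟩ := Fin.ext hil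
      by_cases hd : 0 < (S l).bar.depth (C.position ⟨⟨l + 1, hm⟩, a, false, d⟩).1 f
      · exact eventually_not_sees_of_depth hh (by rwa [hC])
      -- The remaining wall is the one that `watched` would assign if `ownWall` were `.right`. Hence
      -- `ownWall` is another wall, and the guard faces away from the core.
      · refine eventually_not_sees_of_ahead ?_
        have hown : Guard.ownWall ⟨⟨l + 1, hm⟩, a, false, d⟩ = .right →
            (if a then Facing.forward else .left) ≠ f := by
          intro h e
          exact hg (by rw [Guard.watched_of_ownWall_eq h rfl, ← e])
        have h1 := P.start_xc
        have h2 := P.start_yc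
        have h3 := P.finish_xc
        have h4 := P.finish_yc
        rw [Set.mem_Ioo] at h1 h4 hqx
        have h5 := (S l).bar.length_pos
        rw [hp] at hd ⊢
        simp only [hC ⟨l + 1, hm⟩]
        cases a <;> cases d <;> cases f <;>
          simp [Building.depth, Building.ahead, Guard.ownWall] at hd hown hqx hqy ⊢ <;>
          linarith
  -- An upper vertex looks at the core across its own bar.
  · refine eventually_not_sees_of_blocks (j := ⟨l + 1, hm⟩) hh ?_
    have hp : (C.position ⟨⟨l + 1, hm⟩, a, true, d⟩).1 = (S (l + 1)).bar.point
        (if a then (S (l + 1)).bar.length else 0) (S (l + 1)).bar.width := by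
      change (C.building ⟨l + 1, hm⟩).baseVertex a true = _
      rw [hC]; rfl
    rw [hp, hC ⟨l + 1, hm⟩]
    refine Building.blocks_of_above_of_below _ ?_ ?_ hqx hqy
    · cases a <;> simp [hl'.le]
    · simp

theorem eventually_not_sees_of_watched_ne (hC : ∀ i, C.building i = (S i).bar)
    (hS : ∀ n, (S n).Precedes (S (n + 1))) {g : Guard (n + 1)} {i : Fin (n + 1)} {f : Facing}
    (hf : f = .right → i = 0) (hg : g.watched ≠ (i, f)) :
    ∀ᶠ ε in 𝓝[>] (0 : ℝ), ¬ C.Sees g ((C.building i).front ε f, 0) := by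
  rcases lt_trichotomy g.index i with hi | rfl | hi
  · refine eventually_not_sees_later hC hS ?_ hi
    intro h
    exact absurd (hf h ▸ hi) (Fin.not_lt_zero _)
  · refine eventually_not_sees_own (fun i => by rw [hC]; exact (S i).height_eq) ?_
    rintro rfl
    by_cases h : g.ownWall = .right
    · exact hg (Guard.watched_of_index_eq_zero (hf h))
    · exact hg (Guard.watched_of_ownWall_ne h)
  · exact eventually_not_sees_earlier hC hS hi hg

end City

/-! ### Counting guards -/

/-- The walls in front of which the ground is hard to guard: three for every building and a fourth
one for the first building. -/
def guardedWall {n : ℕ} : Option (Fin (n + 1) × Fin 3) → Fin (n + 1) × Facing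
  | none => (0, .right)
  | some (i, 0) => (i, .left)
  | some (i, 1) => (i, .backward)
  | some (i, 2) => (i, .forward)

theorem guardedWall_injective {n : ℕ} : Function.Injective (guardedWall (n := n)) := by
  rintro (_ | ⟨i, a⟩) (_ | ⟨j, b⟩) h
  · rfl
  · fin_cases b <;> simp [guardedWall] at h
  · fin_cases a <;> simp [guardedWall] at h
  · fin_cases a <;> fin_cases b <;> simp_all [guardedWall]

theorem guardedWall_fst_eq_zero {n : ℕ} (w : Option (Fin (n + 1) × Fin 3))
    (h : (guardedWall w).2 = .right) : (guardedWall w).1 = 0 := by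
  rcases w with _ | ⟨i, a⟩
  · rfl
  · fin_cases a <;> simp [guardedWall] at h

theorem City.card_le_of_isGuardedBy {n : ℕ} {C : City (n + 1)} {S : ℕ → Stage}
    (hC : ∀ i, C.building i = (S i).bar) (hS : ∀ n, (S n).Precedes (S (n + 1)))
    {G : Finset (Guard (n + 1))} (hG : C.IsGuardedBy G) : 3 * (n + 1) + 1 ≤ G.card := by
  let p (ε : ℝ) (w : Option (Fin (n + 1) × Fin 3)) : (ℝ × ℝ) × ℝ :=
    ((C.building (guardedWall w).1).front ε (guardedWall w).2, 0)
  have e1 : ∀ᶠ ε in 𝓝[>] (0 : ℝ), ∀ w, p ε w ∈ C.surface :=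
    eventually_all.2 fun w => C.eventually_front_mem_surface _ _
  have e2 : ∀ᶠ ε in 𝓝[>] (0 : ℝ), ∀ g ∈ G, ∀ w, C.Sees g (p ε w) → g.watched = guardedWall w := by
    refine (Filter.eventually_all_finset G).2 fun g _ => eventually_all.2 fun w => ?_
    by_cases h : g.watched = guardedWall w
    · exact Eventually.of_forall fun _ _ => h
    · filter_upwards [C.eventually_not_sees_of_watched_ne hC hS (guardedWall_fst_eq_zero w) h]
        with ε hε hs using absurd hs hε
  -- One `ε` serves all of the finitely many guards and walls.
  obtain ⟨ε, h1, h2⟩ := (e1.and e2).exists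
  choose g hgG hg using fun w => hG _ (h1 w)
  have hinj : Function.Injective g := fun a b hab =>
    guardedWall_injective ((h2 _ (hgG a) _ (hg a)).symm.trans
      (hab ▸ h2 _ (hgG b) _ (hg b)))
  have := Finset.card_le_card_of_injOn g (s := Finset.univ) (t := G) (fun w _ => hgG w)
    hinj.injOn
  simpa [mul_comm] using this

theorem mainTheorem4 (k : ℕ) :
    ∃ C : City k, ∀ G : Finset (Guard k), C.IsGuardedBy G → 3 * k + 1 ≤ G.card := by
  obtain ⟨S, hS⟩ := Stage.exists_sequence
  obtain ⟨C, hC⟩ := Stage.exists_city hS k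
  refine ⟨C, fun G hG => ?_⟩
  cases k with
  -- Without buildings there are no guards, yet the ground is nonempty, so no set guards the city.
  | zero =>
    obtain ⟨g, -⟩ := hG (C.lo, 0) (Or.inl (Or.inl ⟨⟨⟨⟨le_rfl, C.lo_lt_hi_fst.le⟩,
      ⟨le_rfl, C.lo_lt_hi_snd.le⟩⟩, by simp⟩, rfl⟩))
    exact g.index.elim0
  | succ n => exact C.card_le_of_isGuardedBy hC hS hG
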